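/- Let $\Omega$ be a finite set of items and $\mathcal B$ a finite set of bidders. Each bidder $b$ has a valuation $v_b : 2^\Omega \to \mathbb{R}$ with $v_b(\emptyset)=0$ that is monotone ($v_b(S)\le v_b(T)$ for $S\subseteq T$). Vectors are compared item-wise. For prices $p\in\mathbb{R}^\Omega_{\ge 0}$, the demand $D_b(p)$ is the set of all $S\subseteq\Omega$ maximizing $v_b(S)-\sum_{j\in S}p_j$. Assume that every $v_b$ is gross substitute: for all price vectors $p^{(2)}\ge p^{(1)}\ge 0$ and every $D^{(1)}\in D_b(p^{(1)})$ there is $D^{(2)}\in D_b(p^{(2)})$ that contains every $j\in D^{(1)}$ with $p^{(1)}_j=p^{(2)}_j$. Let $r\in\mathbb{R}^\Omega_{\ge 0}$ be reserve prices. An allocation is a family $(\Omega_b)_{b\in\mathcal B}$ of pairwise disjoint subsets of $\Omega$ (items may remain unallocated). It is envy-free at prices $p$ if $\Omega_b\in D_b(p)$ for all $b$, and prices $p$ are envy-free if an envy-free allocation at $p$ exists. A Walrasian equilibrium with reserve prices $r$ consists of prices $p\ge r$ and an allocation that is envy-free at $p$ such that $p_j=r_j$ for every unallocated item $j$; the prices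 $p$ of such an equilibrium are called equilibrium prices with reserve $r$. Then there is a vector $p^*$ that is the least (item-wise minimum) vector of equilibrium prices with reserve $r$, and $p^*$ is also the least envy-free price vector respecting the reserve: $p^*\le p$ for every envy-free price vector $p\ge r$. Consequently, a price vector is a minimal element of the set of envy-free price vectors $p\ge r$ if and only if it equals $p^*$. Moreover, the same holds for every $S\subseteq\Omega$ in the market with item set $S$, the same bidders with their valuations restricted to subsets of $S$, and the reserve prices $(r_j)_{j\in S}$: the minimal envy-free price vector on $S$ respecting the reserve exists, is unique, and equals the least vector of equilibrium prices on $S$ with reserve $(r_j)_{j\in S}$. -/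

import Mathlib

namespace Market

/-- Quasi-linear utility of the bundle `S` at prices `p`. -/
def utility {Ω : Type*} (v : Finset Ω → ℝ) (p : Ω → ℝ) (S : Finset Ω) : ℝ :=
  v S - ∑ j ∈ S, p j

/-- The demand at prices `p`: all bundles of maximum utility. -/
def demand {Ω : Type*} (v : Finset Ω → ℝ) (p : Ω → ℝ) : Set (Finset Ω) :=
  {S | ∀ T : Finset Ω, utility v p T ≤ utility v p S}

/-- Valuations are normalized and monotone. -/
structure IsValuation {Ω : Type*} (v : Finset Ω → ℝ) : Prop where
  empty : v ∅ = 0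
  mono : ∀ S T : Finset Ω, S ⊆ T → v S ≤ v T

/-- The gross-substitute property, over non-negative price vectors. -/
def GrossSubstitute {Ω : Type*} (v : Finset Ω → ℝ) : Prop :=
  ∀ p₁ p₂ : Ω → ℝ, 0 ≤ p₁ → p₁ ≤ p₂ → ∀ D₁ ∈ demand v p₁,
    ∃ D₂ ∈ demand v p₂, ∀ j ∈ D₁, p₁ j = p₂ j → j ∈ D₂

/-- An allocation gives pairwise disjoint bundles; some items may stay unallocated. -/
def IsAllocation {Ω B : Type*} (A : B → Finset Ω) : Prop :=
  ∀ b b' : B, b ≠ b' → Disjoint (A b) (A b')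

/-- `A` is an envy-free allocation at prices `p`. -/
def IsEnvyFree {Ω B : Type*} (v : B → Finset Ω → ℝ) (p : Ω → ℝ) (A : B → Finset Ω) : Prop :=
  IsAllocation A ∧ ∀ b : B, A b ∈ demand (v b) p

/-- `A` and `p` form a Walrasian equilibrium with reserve prices `r`. -/
def IsReserveEquilibrium {Ω B : Type*} (v : B → Finset Ω → ℝ) (r p : Ω → ℝ)
    (A : B → Finset Ω) : Prop :=
  IsEnvyFree v p A ∧ r ≤ p ∧ ∀ j : Ω, (∀ b : B, j ∉ A b) → p j = r j

/-- Envy-free price vectors that respect the reserve prices `r`. -/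
def envyFreePrices {Ω B : Type*} (v : B → Finset Ω → ℝ) (r : Ω → ℝ) : Set (Ω → ℝ) :=
  {p | r ≤ p ∧ ∃ A : B → Finset Ω, IsEnvyFree v p A}

/-- Price vectors of Walrasian equilibria with reserve prices `r`. -/
def reserveEquilibriumPrices {Ω B : Type*} (v : B → Finset Ω → ℝ) (r : Ω → ℝ) :
    Set (Ω → ℝ) :=
  {p | ∃ A : B → Finset Ω, IsReserveEquilibrium v r p A}

/-- The valuation `v` in the market in which only the items of `S` are present. -/
def restrict {Ω : Type*} (S : Finset Ω) (v : Finset Ω → ℝ) : Finset {j // j ∈ S} → ℝ :=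
  fun T => v (T.map (Function.Embedding.subtype (fun j => j ∈ S)))

end Market

/-! Let `lyapunov` be the sum of all indirect utilities and all prices. Gross substitutes make each
indirect utility submodular in the prices (`GrossSubstitute.maxUtility_sup_add_inf_le`), hence also
`lyapunov`. Raising envy-free prices `p` cannot lower `lyapunov`, so for equilibrium prices `q`
submodularity gives `lyapunov (p ⊓ q) ≤ lyapunov q`. This forces `p ⊓ q` to be an equilibrium with
the allocation of `q` (`IsReserveEquilibrium.inf`). Equilibrium prices of minimum sum for one fixed
allocation therefore lie below all envy-free prices. Existence of an equilibrium
(`exists_isReserveEquilibrium`) comes from an ascending auction with small increments, followed by a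
compactness argument. Submarkets inherit the hypotheses by pricing absent items out of reach. -/

namespace Market

/-! ### Indirect utility of a single bidder and its submodularity. -/

section Single

variable {Ω : Type*} {v : Finset Ω → ℝ}

/-- The indirect utility at prices `p`. -/
noncomputable def maxUtility [Fintype Ω] (v : Finset Ω → ℝ) (p : Ω → ℝ) : ℝ :=
  Finset.univ.sup' Finset.univ_nonempty (utility v p)

lemma utility_le_maxUtility [Fintype Ω] (v : Finset Ω → ℝ) (p : Ω → ℝ) (S : Finset Ω) :
    utility v p S ≤ maxUtility v p :=
  Finset.le_sup' (utility v p) (Finset.mem_univ S)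

lemma maxUtility_le [Fintype Ω] {p : Ω → ℝ} {c : ℝ} (h : ∀ S, utility v p S ≤ c) :
    maxUtility v p ≤ c :=
  Finset.sup'_le _ _ fun S _ => h S

lemma mem_demand_iff [Fintype Ω] {p : Ω → ℝ} {S : Finset Ω} :
    S ∈ demand v p ↔ maxUtility v p ≤ utility v p S :=
  ⟨maxUtility_le, fun h T => (utility_le_maxUtility v p T).trans h⟩

lemma utility_eq_maxUtility [Fintype Ω] {p : Ω → ℝ} {S : Finset Ω} (hS : S ∈ demand v p) :
    utility v p S = maxUtility v p :=
  (utility_le_maxUtility v p S).antisymm (mem_demand_iff.1 hS)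

lemma demand_nonempty [Fintype Ω] (v : Finset Ω → ℝ) (p : Ω → ℝ) : (demand v p).Nonempty := by
  obtain ⟨S, -, hS⟩ := Finset.exists_mem_eq_sup' Finset.univ_nonempty (utility v p)
  exact ⟨S, mem_demand_iff.2 hS.le⟩

lemma utility_antitone (v : Finset Ω → ℝ) (S : Finset Ω) : Antitone fun p => utility v p S :=
  fun _ _ h => sub_le_sub_left (Finset.sum_le_sum fun j _ => h j) _

lemma maxUtility_antitone [Fintype Ω] (v : Finset Ω → ℝ) : Antitone (maxUtility v) :=
  fun _ _ h => maxUtility_le fun S =>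
    (utility_antitone v S h).trans (utility_le_maxUtility v _ S)

lemma continuous_utility (v : Finset Ω → ℝ) (S : Finset Ω) :
    Continuous fun p => utility v p S := by
  unfold utility
  fun_prop

/-- A demanded item costs at most the value of the grand bundle. -/
lemma price_le_of_mem_demand [Fintype Ω] (hv : IsValuation v) {p : Ω → ℝ} (hp : 0 ≤ p)
    {D : Finset Ω} (hD : D ∈ demand v p) {j : Ω} (hj : j ∈ D) : p j ≤ v Finset.univ := by
  have h₁ := hD ∅
  have h₂ := hv.mono D Finset.univ (Finset.subset_univ D)
  have h₃ := Finset.single_le_sum (f := p) (fun i _ => hp i) hj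
  simp only [utility, hv.empty, Finset.sum_empty] at h₁
  linarith

lemma utility_update_of_mem [DecidableEq Ω] (p : Ω → ℝ) {j : Ω} (c : ℝ) {S : Finset Ω}
    (hj : j ∈ S) : utility v (Function.update p j c) S = utility v p S - (c - p j) := by
  have h := Finset.sum_update_of_mem hj p c
  have h' := Finset.sum_sdiff (f := p) (Finset.singleton_subset_iff.2 hj)
  simp only [utility, Finset.sum_singleton] at *
  linarith

lemma utility_update_of_notMem [DecidableEq Ω] (p : Ω → ℝ) {j : Ω} (c : ℝ) {S : Finset Ω}
    (hj : j ∉ S) : utility v (Function.update p j c) S = utility v p S := by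
  simp only [utility, Finset.sum_update_of_notMem hj]

/-- Raising one price costs the bidder more when the other prices are higher. -/
lemma GrossSubstitute.maxUtility_update_add_le [Fintype Ω] [DecidableEq Ω]
    (hgs : GrossSubstitute v) {p p' : Ω → ℝ} (hp : 0 ≤ p) (hpp' : p ≤ p') {j : Ω}
    (hj : p j = p' j) {c : ℝ} (hc : p j ≤ c) :
    maxUtility v (Function.update p' j c) + maxUtility v p ≤
      maxUtility v (Function.update p j c) + maxUtility v p' := by
  obtain ⟨D, hD⟩ := demand_nonempty v p
  have hDu := utility_eq_maxUtility hD
  have hmono' : maxUtility v (Function.update p' j c) ≤ maxUtility v p' :=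
    maxUtility_antitone v (le_update_self_iff.2 (hj ▸ hc))
  have hmono : maxUtility v (Function.update p j c) ≤ maxUtility v p :=
    maxUtility_antitone v (le_update_self_iff.2 hc)
  have hle := utility_le_maxUtility v (Function.update p j c) D
  by_cases hjD : j ∈ D
  · rw [utility_update_of_mem p c hjD] at hle
    -- `p j + u` is the threshold price for `j`: `D` is still demanded there, and its utility has
    -- dropped exactly to the optimum at price `c`.
    set u := maxUtility v p - maxUtility v (Function.update p j c) with hu
    have hD₁ : D ∈ demand v (Function.update p j (p j + u)) := by
      intro T
      rw [utility_update_of_mem p _ hjD]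
      by_cases hjT : j ∈ T
      · rw [utility_update_of_mem p _ hjT]
        linarith [hD T]
      · rw [utility_update_of_notMem p _ hjT]
        have h := utility_le_maxUtility v (Function.update p j c) T
        rw [utility_update_of_notMem p _ hjT] at h
        linarith
    have hpu : p ≤ Function.update p j (p j + u) := le_update_self_iff.2 (by linarith)
    obtain ⟨D₂, hD₂, hsub⟩ := hgs _ (Function.update p' j (p j + u)) (hp.trans hpu)
      (update_le_update_iff.2 ⟨le_rfl, fun i _ => hpp' i⟩) D hD₁
    -- Since `j` is still demanded at the higher prices, the raise to `p j + u` costs at least `u`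
    -- there as well.
    have hjD₂ := hsub j hjD (by simp)
    have h₁ := utility_eq_maxUtility hD₂
    rw [utility_update_of_mem p' _ hjD₂] at h₁
    have h₂ := utility_le_maxUtility v p' D₂
    have h₃ : maxUtility v (Function.update p' j c) ≤
        maxUtility v (Function.update p' j (p j + u)) :=
      maxUtility_antitone v
        (update_le_update_iff.2 ⟨by linarith, fun i _ => le_rfl⟩)
    linarith
  · rw [utility_update_of_notMem p c hjD] at hle
    linarith

/-- The indirect utility of a gross-substitute valuation is submodular. -/
lemma GrossSubstitute.maxUtility_sup_add_inf_le [Fintype Ω] (hgs : GrossSubstitute v)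
    {p q : Ω → ℝ} (hp : 0 ≤ p) (hq : 0 ≤ q) :
    maxUtility v (p ⊔ q) + maxUtility v (p ⊓ q) ≤ maxUtility v p + maxUtility v q := by
  classical
  -- The coordinates with `q j < p j` are raised one at a time, in parallel from `q` and from `p ⊓
  -- q`; they end at `p ⊔ q` and `p`.
  have key : ∀ T : Finset Ω, (∀ j ∈ T, q j < p j) →
      maxUtility v (T.piecewise p q) + maxUtility v (p ⊓ q) ≤
        maxUtility v (T.piecewise p (p ⊓ q)) + maxUtility v q := by
    intro T
    induction T using Finset.induction_on with
    | empty => intro _; simp [add_comm]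
    | insert j T hjT ih =>
      intro hT
      have hT' := ih fun i hi => hT i (Finset.mem_insert_of_mem hi)
      have hj := hT j (Finset.mem_insert_self j T)
      rw [Finset.piecewise_insert, Finset.piecewise_insert]
      have h := hgs.maxUtility_update_add_le (p := T.piecewise p (p ⊓ q))
        (p' := T.piecewise p q) (j := j) (c := p j)
        (Finset.le_piecewise_of_le_of_le _ hp (le_inf hp hq))
        (T.piecewise_le_piecewise le_rfl inf_le_right)
        (by simp [hjT, hj.le]) (by simp [hjT])
      linarith
  have h := key (Finset.univ.filter fun j => q j < p j) (by simp)
  have h₁ : (Finset.univ.filter fun j => q j < p j).piecewise p q = p ⊔ q := by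
    ext j
    by_cases hj : q j < p j
    · simp [Finset.piecewise, hj, hj.le]
    · simp [Finset.piecewise, hj, not_lt.1 hj]
  have h₂ : (Finset.univ.filter fun j => q j < p j).piecewise p (p ⊓ q) = p := by
    ext j
    by_cases hj : q j < p j
    · simp [Finset.piecewise, hj]
    · simp [Finset.piecewise, hj, not_lt.1 hj]
  rwa [h₁, h₂] at h

end Single

/-! ### Passage to a submarket. -/

section Restrict

variable {Ω : Type*} {v : Finset Ω → ℝ}

lemma IsValuation.restrict (hv : IsValuation v) (S : Finset Ω) :
    IsValuation (Market.restrict S v) where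
  empty := by simp [Market.restrict, hv.empty]
  mono T T' h := hv.mono _ _ (Finset.map_subset_map.2 h)

lemma GrossSubstitute.restrict [Fintype Ω] (hv : IsValuation v) (hgs : GrossSubstitute v)
    (S : Finset Ω) : GrossSubstitute (Market.restrict S v) := by
  classical
  have hM : 0 ≤ v Finset.univ := hv.empty ▸ hv.mono _ _ (Finset.subset_univ ∅)
  -- Absent items cost more than the grand bundle is worth, so no demanded bundle contains them, and
  -- the two markets have the same demand.
  let ext : ({j // j ∈ S} → ℝ) → Ω → ℝ := fun p j =>
    if h : j ∈ S then p ⟨j, h⟩ else v Finset.univ + 1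
  let emb : Finset {j // j ∈ S} → Finset Ω := fun T =>
    T.map (Function.Embedding.subtype (fun j => j ∈ S))
  have hext : ∀ p, 0 ≤ p → 0 ≤ ext p := by
    intro p hp j
    by_cases h : j ∈ S
    · simpa [ext, h] using hp ⟨j, h⟩
    · simp only [ext, h, dite_false, Pi.zero_apply]
      linarith
  have hutil : ∀ p T, utility v (ext p) (emb T) = utility (Market.restrict S v) p T := by
    intro p T
    simp [utility, Market.restrict, emb, ext]
  have hsub : ∀ p, 0 ≤ p → ∀ D ∈ demand v (ext p), ∃ T, emb T = D := by
    intro p hp D hD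
    refine ⟨D.subtype (fun j => j ∈ S), Finset.subtype_map_of_mem fun j hj => ?_⟩
    by_contra hjS
    have := price_le_of_mem_demand hv (hext p hp) hD hj
    simp only [ext, hjS, dite_false] at this
    linarith
  have hdem : ∀ p, 0 ≤ p → ∀ T, emb T ∈ demand v (ext p) ↔
      T ∈ demand (Market.restrict S v) p := by
    intro p hp T
    refine ⟨fun h T' => by simpa only [hutil] using h (emb T'), fun h => ?_⟩
    obtain ⟨D, hD⟩ := demand_nonempty v (ext p)
    obtain ⟨T', rfl⟩ := hsub p hp D hD
    intro U
    refine (hD U).trans ?_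
    simpa only [hutil] using h T'
  intro p₁ p₂ hp₁ hp D₁ hD₁
  have hp₂ := hp₁.trans hp
  have hle : ext p₁ ≤ ext p₂ := by
    intro j
    by_cases h : j ∈ S
    · simpa [ext, h] using hp ⟨j, h⟩
    · simp [ext, h]
  obtain ⟨D, hD, hD'⟩ := hgs _ _ (hext p₁ hp₁) hle _ ((hdem p₁ hp₁ D₁).2 hD₁)
  obtain ⟨D₂, rfl⟩ := hsub p₂ hp₂ D hD
  refine ⟨D₂, (hdem p₂ hp₂ D₂).1 hD, fun j hj hpj => ?_⟩
  have := hD' j (Finset.mem_map_of_mem (Function.Embedding.subtype (fun j => j ∈ S)) hj)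
    (by simpa [ext] using hpj)
  simpa [emb] using this

end Restrict

/-! ### Existence of equilibria by an ascending auction. -/

section Auction

variable {Ω B : Type*} {v : B → Finset Ω → ℝ} {r p : Ω → ℝ} {ε : ℝ}

open Classical in
/-- The prices faced by a bidder who holds `S`: every other item costs one increment more. -/
noncomputable def bidPrice (p : Ω → ℝ) (ε : ℝ) (S : Finset Ω) : Ω → ℝ :=
  fun j => if j ∈ S then p j else p j + ε

/-- A state of the ascending auction with increment `ε`: item `j` was raised `k j` times and
the bidders provisionally hold the bundles `A b`. -/
structure IsAuctionState (v : B → Finset Ω → ℝ) (r : Ω → ℝ) (ε : ℝ) (k : Ω → ℕ)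
    (A : B → Finset Ω) : Prop where
  isAllocation : IsAllocation A
  exists_demand : ∀ b, ∃ D ∈ demand (v b) (bidPrice (fun j => r j + k j * ε) ε (A b)), A b ⊆ D
  unsold : ∀ j, (∀ b, j ∉ A b) → k j = 0

lemma bidPrice_nonneg (hp : 0 ≤ p) (hε : 0 ≤ ε) (S : Finset Ω) : 0 ≤ bidPrice p ε S := by
  intro j
  have := hp j
  simp only [bidPrice, Pi.zero_apply] at *
  split_ifs <;> linarith

lemma reserve_add_nonneg (hr : 0 ≤ r) (hε : 0 ≤ ε) (k : Ω → ℕ) :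
    0 ≤ fun j => r j + k j * ε :=
  fun j => add_nonneg (hr j) (by positivity)

/-- A raised item has a holder who demands it without surcharge, which bounds its price. The sum
over bidders makes the bound independent of the holder. -/
lemma IsAuctionState.mul_le [Fintype Ω] [Fintype B] {k : Ω → ℕ} {A : B → Finset Ω}
    (h : IsAuctionState v r ε k A) (hv : ∀ b, IsValuation (v b)) (hr : 0 ≤ r) (hε : 0 ≤ ε)
    (j : Ω) : k j * ε ≤ ∑ b, v b Finset.univ := by
  have hnn : ∀ b, 0 ≤ v b Finset.univ := fun b =>
    (hv b).empty ▸ (hv b).mono _ _ (Finset.subset_univ ∅)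
  by_cases hj : ∃ b, j ∈ A b
  · obtain ⟨b, hb⟩ := hj
    obtain ⟨D, hD, hAD⟩ := h.exists_demand b
    have h₁ := price_le_of_mem_demand (hv b)
      (bidPrice_nonneg (reserve_add_nonneg hr hε k) hε _) hD (hAD hb)
    have h₂ := Finset.single_le_sum (f := fun b => v b Finset.univ) (fun b _ => hnn b)
      (Finset.mem_univ b)
    have h₃ := hr j
    simp only [bidPrice, hb, if_true, Pi.zero_apply] at h₁ h₂ h₃
    linarith
  · rw [h.unsold j (not_exists.1 hj)]
    simpa using Finset.sum_nonneg fun b _ => hnn b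

/-- As long as some bidder does not hold a demanded bundle, the auction goes on. -/
lemma IsAuctionState.exists_step [Fintype Ω] (hgs : ∀ b, GrossSubstitute (v b)) (hr : 0 ≤ r)
    (hε : 0 ≤ ε) {k : Ω → ℕ} {A : B → Finset Ω} (h : IsAuctionState v r ε k A) {b : B}
    (hb : A b ∉ demand (v b) (bidPrice (fun j => r j + k j * ε) ε (A b))) :
    ∃ k' A', IsAuctionState v r ε k' A' ∧ ∑ j, k j < ∑ j, k' j := by
  classical
  obtain ⟨D, hD, hAD⟩ := h.exists_demand b
  let k' : Ω → ℕ := fun j => if j ∈ D \ A b then k j + 1 else k j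
  have hkk' : k ≤ k' := fun j => by simp only [k']; split_ifs <;> simp
  -- Bidder `b` seizes all of `D`, and the items new to `b` are raised once.
  refine ⟨k', Function.update (fun b' => A b' \ D) b D, ⟨?_, ?_, ?_⟩, ?_⟩
  · intro b₁ b₂ hne
    rcases eq_or_ne b₁ b with rfl | h₁
    · rw [Function.update_self, Function.update_of_ne hne.symm]
      exact Finset.disjoint_sdiff
    · rw [Function.update_of_ne h₁]
      rcases eq_or_ne b₂ b with rfl | h₂
      · rw [Function.update_self]
        exact Finset.sdiff_disjoint
      · rw [Function.update_of_ne h₂]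
        exact (h.isAllocation b₁ b₂ hne).mono Finset.sdiff_subset Finset.sdiff_subset
  · intro b'
    rcases eq_or_ne b' b with rfl | hne
    · refine ⟨D, ?_, by simp⟩
      rw [Function.update_self]
      -- The seizing bidder faces unchanged prices: on new items the raise replaces the surcharge
      -- for items not held.
      refine (congrArg (demand (v b')) (funext fun j => ?_)).subset hD
      by_cases hjD : j ∈ D
      · by_cases hjA : j ∈ A b'
        · simp [bidPrice, k', hjD, hjA]
        · simp only [bidPrice, k', hjD, hjA, Finset.mem_sdiff, not_false_eq_true, and_self,
            if_true, if_false, Nat.cast_add, Nat.cast_one]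
          ring
      · have hjA : j ∉ A b' := fun hj => hjD (hAD hj)
        simp [bidPrice, k', hjD, hjA]
    · rw [Function.update_of_ne hne]
      obtain ⟨E, hE, hAE⟩ := h.exists_demand b'
      -- The other bidders see prices go up only, and unchanged on the items they keep, so gross
      -- substitutes apply.
      have hle : bidPrice (fun j => r j + k j * ε) ε (A b') ≤
          bidPrice (fun j => r j + k' j * ε) ε (A b' \ D) := by
        intro j
        have hj : (k j : ℝ) * ε ≤ k' j * ε :=
          mul_le_mul_of_nonneg_right (Nat.cast_le.2 (hkk' j)) hε
        simp only [bidPrice, Finset.mem_sdiff]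
        split_ifs <;> first | linarith | tauto
      obtain ⟨E', hE', hEE'⟩ := hgs b' _ _
        (bidPrice_nonneg (reserve_add_nonneg hr hε k) hε _) hle E hE
      refine ⟨E', hE', fun j hj => ?_⟩
      have hj' := Finset.mem_sdiff.1 hj
      exact hEE' j (hAE hj'.1) (by simp [bidPrice, k', hj'.1, hj'.2])
  · intro j hj
    have hjD : j ∉ D := by simpa using hj b
    have : k j = 0 := h.unsold j fun b' hjb => by
      rcases eq_or_ne b' b with rfl | hne
      · exact hjD (hAD hjb)
      · exact hj b' (by simp [Function.update_of_ne hne, hjb, hjD])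
    simp [k', hjD, this]
  · have hne : ∃ j ∈ D, j ∉ A b := by
      by_contra! hsub
      exact hb (hAD.antisymm hsub ▸ hD)
    obtain ⟨j, hjD, hjA⟩ := hne
    exact Finset.sum_lt_sum (fun i _ => hkk' i) ⟨j, Finset.mem_univ j, by simp [k', hjD, hjA]⟩

/-- The ascending auction stops with every bidder holding a demanded bundle. -/
lemma exists_final_auctionState [Fintype Ω] [Fintype B] (hv : ∀ b, IsValuation (v b))
    (hgs : ∀ b, GrossSubstitute (v b)) (hr : 0 ≤ r) (hε : 0 < ε) :
    ∃ k A, IsAuctionState v r ε k A ∧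
      ∀ b, A b ∈ demand (v b) (bidPrice (fun j => r j + k j * ε) ε (A b)) := by
  let s : Set ℕ := {n | ∃ k A, IsAuctionState v r ε k A ∧ ∑ j, k j = n}
  have hne : s.Nonempty := by
    refine ⟨_, fun _ => 0, fun _ => ∅, ⟨?_, ?_, ?_⟩, rfl⟩
    · exact fun _ _ _ => Finset.disjoint_empty_left _
    · intro b
      obtain ⟨D, hD⟩ := demand_nonempty (v b) (bidPrice (fun j => r j + (0 : ℕ) * ε) ε ∅)
      exact ⟨D, hD, Finset.empty_subset D⟩
    · exact fun _ _ => rfl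
  have hbdd : BddAbove s := by
    refine ⟨∑ _j : Ω, ⌊(∑ b, v b Finset.univ) / ε⌋₊, ?_⟩
    rintro _ ⟨k, A, h, rfl⟩
    exact Finset.sum_le_sum fun j _ =>
      Nat.le_floor ((le_div_iff₀ hε).2 (h.mul_le hv hr hε.le j))
  -- A state with the largest total number of raises admits no further step.
  obtain ⟨k, A, h, hk⟩ := Nat.sSup_mem hne hbdd
  refine ⟨k, A, h, fun b => ?_⟩
  by_contra hb
  obtain ⟨k', A', h', hlt⟩ := h.exists_step hgs hr hε.le hb
  exact absurd (le_csSup hbdd ⟨k', A', h', rfl⟩) (not_le.2 (hk ▸ hlt))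

/-- Prices between `r` and `r + c` at which the bundles of `A` are within `ε` of the maximum
utility and the unallocated items cost their reserve. -/
def approxEquilibriumPrices (v : B → Finset Ω → ℝ) (r : Ω → ℝ) (c : ℝ) (A : B → Finset Ω)
    (ε : ℝ) : Set (Ω → ℝ) :=
  {p | p ∈ Set.Icc r (fun j => r j + c) ∧
    (∀ b T, utility (v b) p T ≤ utility (v b) p (A b) + ε) ∧
    ∀ j, (∀ b, j ∉ A b) → p j = r j}

lemma approxEquilibriumPrices_mono (v : B → Finset Ω → ℝ) (r : Ω → ℝ) (c : ℝ)
    (A : B → Finset Ω) : Monotone (approxEquilibriumPrices v r c A) :=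
  fun _ _ h _ hp => ⟨hp.1, fun b T => (hp.2.1 b T).trans (by linarith), hp.2.2⟩

lemma isCompact_approxEquilibriumPrices (v : B → Finset Ω → ℝ) (r : Ω → ℝ) (c : ℝ)
    (A : B → Finset Ω) (ε : ℝ) : IsCompact (approxEquilibriumPrices v r c A ε) := by
  have h₁ : IsClosed {p : Ω → ℝ | ∀ b T, utility (v b) p T ≤ utility (v b) p (A b) + ε} := by
    simp only [Set.ofPred_forall]
    exact isClosed_iInter fun b => isClosed_iInter fun T =>
      isClosed_le (continuous_utility _ _) ((continuous_utility _ _).add continuous_const)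
  have h₂ : IsClosed {p : Ω → ℝ | ∀ j, (∀ b, j ∉ A b) → p j = r j} := by
    simp only [Set.ofPred_forall]
    exact isClosed_iInter fun j => isClosed_iInter fun _ =>
      isClosed_eq (continuous_apply j) continuous_const
  exact isCompact_Icc.inter_right (h₁.inter h₂)

lemma exists_approxEquilibrium [Fintype Ω] [Fintype B] (hv : ∀ b, IsValuation (v b))
    (hgs : ∀ b, GrossSubstitute (v b)) (hr : 0 ≤ r) (hε : 0 < ε) :
    ∃ A, IsAllocation A ∧
      (approxEquilibriumPrices v r (∑ b, v b Finset.univ) A ε).Nonempty := by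
  -- The surcharges on a bundle total at most `Fintype.card Ω * δ ≤ ε`; the `+ 1` keeps the
  -- denominator positive when there are no items.
  set δ := ε / (Fintype.card Ω + 1)
  have hδ : 0 < δ := by positivity
  obtain ⟨k, A, h, hA⟩ := exists_final_auctionState hv hgs hr hδ
  refine ⟨A, h.isAllocation, fun j => r j + k j * δ, ⟨fun j => ?_, fun j => ?_⟩, fun b T => ?_,
    fun j hj => ?_⟩
  · exact le_add_of_nonneg_right (by positivity)
  · exact add_le_add_right (h.mul_le hv hr hδ.le j) _
  · have h₁ := hA b T
    have h₂ : ∑ j ∈ T, bidPrice (fun j => r j + k j * δ) δ (A b) j ≤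
        ∑ j ∈ T, (r j + k j * δ) + ε := by
      calc ∑ j ∈ T, bidPrice (fun j => r j + k j * δ) δ (A b) j
          ≤ ∑ j ∈ T, ((r j + k j * δ) + δ) := Finset.sum_le_sum fun j _ => by
            simp only [bidPrice]; split_ifs <;> linarith
        _ = ∑ j ∈ T, (r j + k j * δ) + T.card * δ := by
            rw [Finset.sum_add_distrib]; simp
        _ ≤ ∑ j ∈ T, (r j + k j * δ) + (Fintype.card Ω + 1) * δ := by
            have : (T.card : ℝ) ≤ Fintype.card Ω + 1 := by
              exact_mod_cast (Finset.card_le_univ T).trans (Nat.le_succ _)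
            gcongr
        _ = _ := by
            congr 1
            exact mul_div_cancel₀ ε (by positivity)
    have h₃ : ∑ j ∈ A b, bidPrice (fun j => r j + k j * δ) δ (A b) j =
        ∑ j ∈ A b, (r j + k j * δ) :=
      Finset.sum_congr rfl fun j hj => by simp [bidPrice, hj]
    simp only [utility] at h₁ ⊢
    linarith
  · simp [h.unsold j hj]

/-- There are finitely many allocations, so one of them works for arbitrarily small errors; its
nested compact sets of approximate prices have a common point. -/
theorem exists_isReserveEquilibrium [Fintype Ω] [Fintype B] (hv : ∀ b, IsValuation (v b))
    (hgs : ∀ b, GrossSubstitute (v b)) (hr : 0 ≤ r) :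
    ∃ p A, IsReserveEquilibrium v r p A := by
  classical
  set c := ∑ b, v b Finset.univ
  let ε : ℕ → ℝ := fun n => 1 / ((n : ℝ) + 1)
  have hanti : Antitone ε := fun _ _ h => Nat.one_div_le_one_div h
  have hA : ∃ A, IsAllocation A ∧ ∀ n, (approxEquilibriumPrices v r c A (ε n)).Nonempty := by
    by_contra! hcon
    choose! N hN using hcon
    -- If every allocation failed at some error level, all would fail at the common level `M`, by
    -- monotonicity.
    obtain ⟨M, hM⟩ := (Set.finite_range N).bddAbove
    obtain ⟨A, hAa, hAne⟩ := exists_approxEquilibrium hv hgs hr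
      (show 0 < ε M from Nat.one_div_pos_of_nat)
    have := hAne.mono (approxEquilibriumPrices_mono v r c A (hanti (hM ⟨A, rfl⟩)))
    exact this.ne_empty (hN A hAa)
  obtain ⟨A, hAa, hAne⟩ := hA
  obtain ⟨p, hp⟩ := IsCompact.nonempty_iInter_of_sequence_nonempty_isCompact_isClosed
    (fun n => approxEquilibriumPrices v r c A (ε n))
    (fun n => approxEquilibriumPrices_mono v r c A (hanti n.le_succ)) hAne
    (isCompact_approxEquilibriumPrices v r c A _)
    (fun n => (isCompact_approxEquilibriumPrices v r c A _).isClosed)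
  rw [Set.mem_iInter] at hp
  refine ⟨p, A, ⟨hAa, fun b T => ?_⟩, (hp 0).1.1, (hp 0).2.2⟩
  have hlim : Filter.Tendsto (fun n => utility (v b) p (A b) + ε n) Filter.atTop
      (nhds (utility (v b) p (A b) + 0)) :=
    tendsto_const_nhds.add tendsto_one_div_add_atTop_nhds_zero_nat
  rw [add_zero] at hlim
  exact ge_of_tendsto' hlim fun n => (hp n).2.1 b T

end Auction

/-! ### The Lyapunov function and meets of price vectors. -/

section Lattice

variable {Ω B : Type*} [Fintype Ω] [Fintype B] {v : B → Finset Ω → ℝ} {r p q : Ω → ℝ}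
  {A : B → Finset Ω}

/-- The sum of the indirect utilities and the prices. -/
noncomputable def lyapunov (v : B → Finset Ω → ℝ) (p : Ω → ℝ) : ℝ :=
  ∑ b, maxUtility (v b) p + ∑ j, p j

open Classical in
lemma sum_utility_add_sum (hA : IsAllocation A) (p : Ω → ℝ) :
    ∑ b, utility (v b) p (A b) + ∑ j, p j =
      ∑ b, v b (A b) + ∑ j ∈ (Finset.univ.biUnion A)ᶜ, p j := by
  have h₁ : ∑ j ∈ Finset.univ.biUnion A, p j = ∑ b, ∑ j ∈ A b, p j :=
    Finset.sum_biUnion fun b _ b' _ h => hA b b' h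
  have h₂ := Finset.sum_add_sum_compl (Finset.univ.biUnion A) p
  simp only [utility, Finset.sum_sub_distrib]
  linarith

-- Weak duality: payments for sold items cancel, and indirect utility dominates the utility of the
-- assigned bundle. Envy-freeness is the case of equality.
open Classical in
lemma le_lyapunov (hA : IsAllocation A) (p : Ω → ℝ) :
    ∑ b, v b (A b) + ∑ j ∈ (Finset.univ.biUnion A)ᶜ, p j ≤ lyapunov v p := by
  rw [← sum_utility_add_sum hA]
  exact add_le_add_left (Finset.sum_le_sum fun b _ => utility_le_maxUtility _ _ _) _

open Classical in
lemma IsEnvyFree.lyapunov_eq (h : IsEnvyFree v p A) :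
    lyapunov v p = ∑ b, v b (A b) + ∑ j ∈ (Finset.univ.biUnion A)ᶜ, p j := by
  rw [← sum_utility_add_sum h.1, lyapunov]
  exact congrArg (· + _) (Finset.sum_congr rfl fun b _ => (utility_eq_maxUtility (h.2 b)).symm)

/-- The lower bound of `le_lyapunov` for `A` is attained at `p` and grows with the prices of unsold
items. -/
lemma IsEnvyFree.lyapunov_le (h : IsEnvyFree v p A) (hpq : p ≤ q) :
    lyapunov v p ≤ lyapunov v q := by
  classical
  rw [h.lyapunov_eq]
  exact (add_le_add_right (Finset.sum_le_sum fun j _ => hpq j) _).trans (le_lyapunov h.1 q)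

/-- An allocation that is in equilibrium at some prices is in equilibrium at all prices that
do at least as well for the Lyapunov function. -/
lemma IsReserveEquilibrium.of_lyapunov_le (h : IsReserveEquilibrium v r p A) (hrq : r ≤ q)
    (hq : lyapunov v q ≤ lyapunov v p) : IsReserveEquilibrium v r q A := by
  classical
  obtain ⟨hef, hrp, hres⟩ := h
  set U := (Finset.univ.biUnion A)ᶜ with hU
  have hpU : ∑ j ∈ U, p j = ∑ j ∈ U, r j :=
    Finset.sum_congr rfl fun j hj => hres j (by simpa [hU] using hj)
  have hrU : ∑ j ∈ U, r j ≤ ∑ j ∈ U, q j := Finset.sum_le_sum fun j _ => hrq j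
  have h₁ := hef.lyapunov_eq
  have h₂ := sum_utility_add_sum (v := v) hef.1 q
  have h₃ : ∑ b, utility (v b) q (A b) ≤ ∑ b, maxUtility (v b) q :=
    Finset.sum_le_sum fun b _ => utility_le_maxUtility _ _ _
  rw [← hU] at h₁ h₂
  rw [h₁, hpU, lyapunov] at hq
  -- `hq` closes the chain of `h₃` and `hrU`, so both are equalities, and termwise equality gives
  -- demand and reserve prices.
  have h₄ : ∑ b, utility (v b) q (A b) = ∑ b, maxUtility (v b) q := by linarith
  have h₅ : ∑ j ∈ U, r j = ∑ j ∈ U, q j := by linarith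
  refine ⟨⟨hef.1, fun b => mem_demand_iff.2 ?_⟩, hrq, fun j hj => ?_⟩
  · exact ((Finset.sum_eq_sum_iff_of_le fun b _ => utility_le_maxUtility _ _ _).1 h₄ b
      (Finset.mem_univ b)).ge
  · exact ((Finset.sum_eq_sum_iff_of_le fun j _ => hrq j).1 h₅ j (by simpa [hU] using hj)).symm

lemma lyapunov_sup_add_inf_le (hgs : ∀ b, GrossSubstitute (v b)) (hp : 0 ≤ p) (hq : 0 ≤ q) :
    lyapunov v (p ⊔ q) + lyapunov v (p ⊓ q) ≤ lyapunov v p + lyapunov v q := by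
  have h₁ := Finset.sum_le_sum fun b (_ : b ∈ Finset.univ) =>
    (hgs b).maxUtility_sup_add_inf_le hp hq
  have h₂ : ∑ j, ((p ⊔ q) j + (p ⊓ q) j) = ∑ j, (p j + q j) :=
    Finset.sum_congr rfl fun j _ => max_add_min (p j) (q j)
  simp only [Finset.sum_add_distrib] at h₁ h₂
  simp only [lyapunov]
  linarith

/-- The meet of equilibrium prices and envy-free prices consists of equilibrium prices. -/
lemma IsReserveEquilibrium.inf (hgs : ∀ b, GrossSubstitute (v b)) (hr : 0 ≤ r)
    (hq : IsReserveEquilibrium v r q A) (hp : p ∈ envyFreePrices v r) :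
    IsReserveEquilibrium v r (p ⊓ q) A := by
  obtain ⟨hrp, A', hA'⟩ := hp
  refine hq.of_lyapunov_le (le_inf hrp hq.2.1) ?_
  have h₁ := lyapunov_sup_add_inf_le hgs (hr.trans hrp) (hr.trans hq.2.1)
  have h₂ := hA'.lyapunov_le (le_sup_left : p ≤ p ⊔ q)
  linarith

/-- Places the equilibrium prices supported by `A` in a compact set, where a minimum can be taken.
-/
lemma IsReserveEquilibrium.mem_approxEquilibriumPrices (hv : ∀ b, IsValuation (v b))
    (hr : 0 ≤ r) (hp : IsReserveEquilibrium v r p A) :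
    p ∈ approxEquilibriumPrices v r (∑ b, v b Finset.univ) A 0 := by
  have hnn : ∀ b, 0 ≤ v b Finset.univ := fun b =>
    (hv b).empty ▸ (hv b).mono _ _ (Finset.subset_univ ∅)
  refine ⟨⟨hp.2.1, fun j => ?_⟩, fun b T => by simpa using hp.1.2 b T, hp.2.2⟩
  by_cases hj : ∃ b, j ∈ A b
  · obtain ⟨b, hb⟩ := hj
    have h₁ := price_le_of_mem_demand (hv b) (hr.trans hp.2.1) (hp.1.2 b) hb
    have h₂ := Finset.single_le_sum (f := fun b => v b Finset.univ) (fun b _ => hnn b)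
      (Finset.mem_univ b)
    have h₃ := hr j
    simp only [Pi.zero_apply] at h₂ h₃
    linarith
  · rw [hp.2.2 j (not_exists.1 hj)]
    exact le_add_of_nonneg_right (Finset.sum_nonneg fun b _ => hnn b)

end Lattice

theorem exists_isLeast_prices {Ω B : Type*} [Finite Ω] [Finite B] {v : B → Finset Ω → ℝ}
    (hv : ∀ b, IsValuation (v b)) (hgs : ∀ b, GrossSubstitute (v b)) {r : Ω → ℝ} (hr : 0 ≤ r) :
    ∃ q, IsLeast (reserveEquilibriumPrices v r) q ∧ IsLeast (envyFreePrices v r) q ∧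
      ∀ p, Minimal (fun p' => p' ∈ envyFreePrices v r) p ↔ p = q := by
  have := Fintype.ofFinite Ω
  have := Fintype.ofFinite B
  obtain ⟨p₀, A, h₀⟩ := exists_isReserveEquilibrium hv hgs hr
  obtain ⟨q, hq, hmin⟩ := (isCompact_approxEquilibriumPrices v r (∑ b, v b Finset.univ) A
    0).exists_isMinOn ⟨p₀, h₀.mem_approxEquilibriumPrices hv hr⟩
    (f := fun p => ∑ j, p j) (by fun_prop)
  have hqe : IsReserveEquilibrium v r q A :=
    ⟨⟨h₀.1.1, fun b T => by simpa using hq.2.1 b T⟩, hq.1.1, hq.2.2⟩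
  have hlow : q ∈ lowerBounds (envyFreePrices v r) := by
    intro p hp
    -- The meet competes for the minimum sum because it is supported by the same allocation `A`;
    -- being below `q`, it must equal `q`.
    have hle := hmin ((hqe.inf hgs hr hp).mem_approxEquilibriumPrices hv hr)
    have heq : ∑ j, (p ⊓ q) j = ∑ j, q j :=
      le_antisymm (Finset.sum_le_sum fun j _ => inf_le_right) hle
    intro j
    have := (Finset.sum_eq_sum_iff_of_le fun j _ => (inf_le_right : (p ⊓ q) j ≤ q j)).1 heq j
      (Finset.mem_univ j)
    exact this ▸ inf_le_left
  have hsub : reserveEquilibriumPrices v r ⊆ envyFreePrices v r :=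
    fun p ⟨A', h⟩ => ⟨h.2.1, A', h.1⟩
  have hmem : q ∈ reserveEquilibriumPrices v r := ⟨A, hqe⟩
  have hleast : IsLeast (envyFreePrices v r) q := ⟨hsub hmem, hlow⟩
  exact ⟨q, ⟨hmem, fun p hp => hlow (hsub hp)⟩, hleast, fun p => hleast.minimal_iff⟩

end Market

theorem mainTheorem4 {Ω B : Type*} [Finite Ω] [Finite B]
    (v : B → Finset Ω → ℝ) (hv : ∀ b : B, Market.IsValuation (v b))
    (hgs : ∀ b : B, Market.GrossSubstitute (v b))
    (r : Ω → ℝ) (hr : 0 ≤ r) :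
    (∃ q : Ω → ℝ,
      IsLeast (Market.reserveEquilibriumPrices v r) q ∧
      IsLeast (Market.envyFreePrices v r) q ∧
      ∀ p : Ω → ℝ, Minimal (fun p' => p' ∈ Market.envyFreePrices v r) p ↔ p = q) ∧
    ∀ S : Finset Ω, ∃ q : {j // j ∈ S} → ℝ,
      IsLeast (Market.reserveEquilibriumPrices
        (fun b => Market.restrict S (v b)) (fun j => r j.1)) q ∧
      IsLeast (Market.envyFreePrices
        (fun b => Market.restrict S (v b)) (fun j => r j.1)) q ∧
      ∀ p : {j // j ∈ S} → ℝ,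
        Minimal (fun p' => p' ∈ Market.envyFreePrices
          (fun b => Market.restrict S (v b)) (fun j => r j.1)) p ↔ p = q := by
  have := Fintype.ofFinite Ω
  exact ⟨Market.exists_isLeast_prices hv hgs hr, fun S =>
    Market.exists_isLeast_prices (fun b => (hv b).restrict S) (fun b => (hgs b).restrict (hv b) S)
      fun j => hr j.1⟩
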